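/- Let $d\ge 1$, let $E_1,\dots,E_d\in\mathbb{R}$ be energies, $\beta\in\mathbb{R}$ an inverse temperature, and let $\gamma=(\gamma_1,\dots,\gamma_d)$, $\gamma_i=e^{-\beta E_i}/\sum_{j=1}^d e^{-\beta E_j}$, be the Gibbs distribution. Let $\Delta_d\subset\mathbb{R}^d$ be the simplex of probability vectors and $H_d=\{x\in\mathbb{R}^d:\sum_i x_i=1\}$ the hyperplane of quasi-probability vectors. A Gibbs-preserving matrix is a $d\times d$ matrix $\Lambda$ with $\Lambda_{ij}\ge 0$, $\sum_i\Lambda_{ij}=1$ for all $j$, and $\Lambda\gamma=\gamma$. For $x\in H_d$ the future thermal cone is $$\mathcal{T}^\beta_+(x)=\{\Lambda x:\Lambda\text{ Gibbs-preserving}\}.$$ For $p\in\Delta_d$ the past thermal cone is $\mathcal{T}^\beta_-(p)=\{q\in\Delta_d: \Lambda q=p\text{ for some Gibbs-preserving }\Lambda\}$, and the incomparable thermal region is $\mathcal{T}^\beta_\emptyset(p)=\Delta_d\setminus\big(\mathcal{T}^\beta_+(p)\cup\mathcal{T}^\beta_-(p)\big)$. Let $p\in\Delta_d$ and let $\pi_p$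 be any $\beta$-ordering of $p$, that is, a permutation of $\{1,\dots,d\}$ such that $p_{\pi_p^{-1}(i)}/\gamma_{\pi_p^{-1}(i)}$ is non-increasing in $i$. Write $p^\beta_i=p_{\pi_p^{-1}(i)}$ and $\gamma^\beta_i=\gamma_{\pi_p^{-1}(i)}$. If $d\ge 2$, define for every permutation $\pi\in\mathcal{S}_d$ and every $n\in\{1,\dots,d\}$ the thermal tangent vector $t^{(n,\pi)}\in H_d$ by $$t^{(n,\pi)}_{\pi(1)}=\sum_{i=1}^{n}p^\beta_i-\frac{p^\beta_n}{\gamma^\beta_n}\Big(\sum_{i=1}^{n}\gamma^\beta_i-\gamma_{\pi(1)}\Big),\qquad t^{(n,\pi)}_{\pi(k)}=\frac{p^\beta_n}{\gamma^\beta_n}\gamma_{\pi(k)}\quad(1<k<d),$$ $$t^{(n,\pi)}_{\pi(d)}=1-t^{(n,\pi)}_{\pi(1)}-\frac{p^\beta_n}{\gamma^\beta_n}\sum_{i=2}^{d-1}\gamma_{\pi(i)}.$$ Let $$\mathbb{T}^\beta=\bigcup_{\pi\in\mathcal{S}_d}\ \bigcup_{i=1}^{d-1}\operatorname{conv}\Big[\mathcal{T}^\beta_+\big(t^{(i,\pi)}\big)\cup\mathcal{T}^\beta_+\big(t^{(i+1,\pi)}\big)\Big]$$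 (the empty set if $d=1$), and let $\operatorname{int}(\mathbb{T}^\beta)$ be its interior in the topology of $H_d$. Then $$\mathcal{T}^\beta_\emptyset(p)=\big[\operatorname{int}(\mathbb{T}^\beta)\setminus\mathcal{T}^\beta_+(p)\big]\cap\Delta_d .$$ -/

import Mathlib

open scoped Matrix BigOperators

noncomputable section

/-- The Gibbs distribution at inverse temperature `β` of a `d`-level system with energies `E`:
`γ i = exp (-β E i) / Z`, where `Z = ∑ j, exp (-β E j)`. -/
def gibbsState {d : ℕ} (β : ℝ) (E : Fin d → ℝ) : Fin d → ℝ :=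
  fun i => Real.exp (-β * E i) / ∑ j, Real.exp (-β * E j)

/-- The Gibbs-preserving matrices: (column-)stochastic matrices `Λ` with `Λ γ = γ`. -/
def gibbsPreserving {d : ℕ} (γ : Fin d → ℝ) : Set (Matrix (Fin d) (Fin d) ℝ) :=
  {Λ | Λ ∈ Matrix.colStochastic ℝ (Fin d) ∧ Λ *ᵥ γ = γ}

/-- The future thermal cone of a vector `x`, which may be a quasi-probability distribution:
everything that `x` is mapped to by a Gibbs-preserving matrix. If `x` is a probability vector,
so is every element of its future thermal cone. -/
def futureCone {d : ℕ} (γ x : Fin d → ℝ) : Set (Fin d → ℝ) :=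
  {y | ∃ Λ ∈ gibbsPreserving γ, Λ *ᵥ x = y}

/-- The past thermal cone of a probability vector `p`: the probability vectors that are mapped to
`p` by a Gibbs-preserving matrix. -/
def pastCone {d : ℕ} (γ p : Fin d → ℝ) : Set (Fin d → ℝ) :=
  {q ∈ stdSimplex ℝ (Fin d) | ∃ Λ ∈ gibbsPreserving γ, Λ *ᵥ q = p}

/-- The incomparable thermal region of `p`: the probability vectors that are neither in the future
nor in the past thermal cone of `p`. -/
def incomparableRegion {d : ℕ} (γ p : Fin d → ℝ) : Set (Fin d → ℝ) :=
  {q ∈ stdSimplex ℝ (Fin d) | q ∉ futureCone γ p ∧ q ∉ pastCone γ p}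

/-- `σ` is a `β`-ordering of `p`: the quotients `p (σ⁻¹ i) / γ (σ⁻¹ i)` do not increase with `i`.
It is not unique if some of the quotients coincide. -/
def IsBetaOrdering {d : ℕ} (γ p : Fin d → ℝ) (σ : Equiv.Perm (Fin d)) : Prop :=
  Antitone fun i : Fin d => p (σ⁻¹ i) / γ (σ⁻¹ i)

/-- The vector `x` rearranged by `σ`: its `i`-th entry is `x (σ⁻¹ i)`. -/
def reorder {d : ℕ} (σ : Equiv.Perm (Fin d)) (x : Fin d → ℝ) : Fin d → ℝ :=
  fun i => x (σ⁻¹ i)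

/-- The slope `p^β_n / γ^β_n`, where `p^β` and `γ^β` are `p` and `γ` in the order `σ`. -/
def tangentSlope {d : ℕ} (γ p : Fin d → ℝ) (σ : Equiv.Perm (Fin d)) (n : Fin d) : ℝ :=
  reorder σ p n / reorder σ γ n

/-- The entry at index `π 1` (here `π 0`, as indices start from zero) of the tangent vector
`t^(n,π)`. -/
def tangentFirst {d : ℕ} (γ p : Fin d → ℝ) (σ : Equiv.Perm (Fin d)) (n : Fin d)
    (π : Equiv.Perm (Fin d)) : ℝ :=
  (∑ i ∈ Finset.Iic n, reorder σ p i) -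
    tangentSlope γ p σ n * ((∑ i ∈ Finset.Iic n, reorder σ γ i) - γ (π ⟨0, n.pos⟩))

/-- The entry at index `π d` (here `π (d - 1)`) of the tangent vector `t^(n,π)`; the sum runs over
all positions except the first and the last one. -/
def tangentLast {d : ℕ} (γ p : Fin d → ℝ) (σ : Equiv.Perm (Fin d)) (n : Fin d)
    (π : Equiv.Perm (Fin d)) : ℝ :=
  1 - tangentFirst γ p σ n π -
    tangentSlope γ p σ n * ∑ i : Fin d with 0 < i.val ∧ i.val + 1 < d, γ (π i)

/-- The list of the entries of the tangent vector `t^(n,π)` at the indices `π 1, …, π d`, in this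
order. -/
def tangentOrdered {d : ℕ} (γ p : Fin d → ℝ) (σ : Equiv.Perm (Fin d)) (n : Fin d)
    (π : Equiv.Perm (Fin d)) : Fin d → ℝ :=
  fun k =>
    if k.val = 0 then tangentFirst γ p σ n π
    else if k.val + 1 = d then tangentLast γ p σ n π
    else tangentSlope γ p σ n * γ (π k)

/-- The thermal tangent vector `t^(n,π)` of `p`, whose entry at index `π k` is the `k`-th entry of
`tangentOrdered`. -/
def tangentVector {d : ℕ} (γ p : Fin d → ℝ) (σ : Equiv.Perm (Fin d)) (n : Fin d)
    (π : Equiv.Perm (Fin d)) : Fin d → ℝ :=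
  fun j => tangentOrdered γ p σ n π (π⁻¹ j)

/-- The union, over all permutations `π` and all pairs of consecutive indices, of the convex hulls
of the future thermal cones of two consecutive tangent vectors. -/
def tangentRegion {d : ℕ} (γ p : Fin d → ℝ) (σ : Equiv.Perm (Fin d)) : Set (Fin d → ℝ) :=
  ⋃ (π : Equiv.Perm (Fin d)) (i : ℕ) (hi : i + 1 < d),
    convexHull ℝ
      (futureCone γ (tangentVector γ p σ ⟨i, Nat.lt_of_succ_lt hi⟩ π) ∪
        futureCone γ (tangentVector γ p σ ⟨i + 1, hi⟩ π))

/-- The hyperplane of normalised real vectors (quasi-probability distributions). -/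
def quasiSimplex (d : ℕ) : Set (Fin d → ℝ) :=
  {x | ∑ i, x i = 1}

/-- The interior of a set of quasi-probability distributions, with respect to the topology of the
hyperplane of all quasi-probability distributions. -/
def quasiInterior {d : ℕ} (S : Set (Fin d → ℝ)) : Set (Fin d → ℝ) :=
  Subtype.val '' interior {x : quasiSimplex d | (x : Fin d → ℝ) ∈ S}

end

/-! The tool is `excess γ x m`, the convex conjugate of the thermomajorisation curve of `x`. For
vectors of equal total, `y ∈ futureCone γ x` holds exactly when `excess γ y ≤ excess γ x` at every
slope (`excess_le_of_mem_futureCone`, `mem_futureCone_of_excess_le`).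

If `q` is not in the past cone of `p`, then `excess γ q m < excess γ p m` for some `m`: the curve of
`q` stays strictly below the supporting line of slope `m` to the curve of `p`. That line is a convex
combination of the tangents along two consecutive segments, so a single Gibbs-preserving matrix maps
the same combination of two tangent vectors to `q`. The strict inequality is an open condition,
hence `q` is interior (`mem_quasiInterior_of_excess_lt`).

Conversely, the curve of any element of the tangent region does not exceed that of `p` at some inner
elbow (`exists_elbow_of_mem_tangentRegion`). If `q` is in the past but not in the future cone, then
`q ≠ γ`, and its curve lies above that of `p` and strictly above the diagonal. Pushing `q` slightly
away from `γ` lifts its curve strictly above that of `p` at every inner elbow, so `q` is not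
interior. -/

/-- The total amount by which `x` exceeds `m * γ`. As a function of `m` this is the conjugate of
the thermomajorisation curve of `x`. -/
def excess {ι : Type*} [Fintype ι] (γ x : ι → ℝ) (m : ℝ) : ℝ :=
  ∑ i, max (x i - m * γ i) 0

/-! ### The conjugate of the thermomajorisation curve -/

section Excess

variable {ι : Type*} [Fintype ι] {γ x y : ι → ℝ} {m : ℝ}

lemma excess_nonneg : 0 ≤ excess γ x m :=
  Finset.sum_nonneg fun _ _ => le_max_right _ _

/-- Weak duality: the excess is the maximum over weights in `[0, 1]`, attained at the indicator of
the positive terms. -/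
lemma sum_mul_sub_le_excess {b : ι → ℝ} (hb0 : ∀ i, 0 ≤ b i) (hb1 : ∀ i, b i ≤ 1) :
    ∑ i, b i * x i - m * ∑ i, b i * γ i ≤ excess γ x m := by
  rw [Finset.mul_sum, ← Finset.sum_sub_distrib]
  refine Finset.sum_le_sum fun i _ => ?_
  have h1 : b i * (x i - m * γ i) ≤ b i * max (x i - m * γ i) 0 :=
    mul_le_mul_of_nonneg_left (le_max_left _ _) (hb0 i)
  have h2 : b i * max (x i - m * γ i) 0 ≤ 1 * max (x i - m * γ i) 0 :=
    mul_le_mul_of_nonneg_right (hb1 i) (le_max_right _ _)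
  linarith

lemma sum_sub_le_excess : ∑ i, x i - m * ∑ i, γ i ≤ excess γ x m := by
  simpa using sum_mul_sub_le_excess (γ := γ) (x := x) (m := m) (b := fun _ => 1)
    (fun _ => zero_le_one) (fun _ => le_rfl)

/-- The excess, expressed by the total amount by which `x` falls short of `m * γ`. -/
lemma excess_eq_add_deficit :
    excess γ x m = ∑ i, x i - m * ∑ i, γ i + ∑ i, max (m * γ i - x i) 0 := by
  rw [excess, Finset.mul_sum, ← Finset.sum_sub_distrib, ← Finset.sum_add_distrib]
  refine Finset.sum_congr rfl fun i _ => ?_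
  rcases le_total (x i) (m * γ i) with h | h
  · rw [max_eq_right (by linarith), max_eq_left (by linarith)]; ring
  · rw [max_eq_left (by linarith), max_eq_right (by linarith)]; ring

lemma continuous_excess : Continuous fun x : ι → ℝ => excess γ x m := by
  unfold excess
  fun_prop

end Excess

/-! ### Monotonicity of the excess; convexity and compactness of future cones -/

section GibbsPreserving

variable {d : ℕ} {γ x y : Fin d → ℝ} {Λ : Matrix (Fin d) (Fin d) ℝ}

lemma mem_gibbsPreserving :
    Λ ∈ gibbsPreserving γ ↔
      (∀ i j, 0 ≤ Λ i j) ∧ (∀ j, ∑ i, Λ i j = 1) ∧ ∀ i, ∑ j, Λ i j * γ j = γ i := by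
  simp only [gibbsPreserving, Set.mem_ofPred_eq, Matrix.mem_colStochastic_iff_sum, and_assoc,
    funext_iff, Matrix.mulVec, dotProduct]

/-- Since `Λ` fixes `γ`, it maps `x - m γ` to `Λ x - m γ`; then `max · 0` is sublinear and the
columns of `Λ` sum to one. -/
lemma excess_mulVec_le (hΛ : Λ ∈ gibbsPreserving γ) (m : ℝ) :
    excess γ (Λ *ᵥ x) m ≤ excess γ x m := by
  obtain ⟨h0, h1, h2⟩ := mem_gibbsPreserving.1 hΛ
  calc excess γ (Λ *ᵥ x) m ≤ ∑ i, ∑ j, Λ i j * max (x j - m * γ j) 0 := by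
        refine Finset.sum_le_sum fun i _ => max_le ?_ ?_
        · rw [← h2 i, Matrix.mulVec, dotProduct, Finset.mul_sum, ← Finset.sum_sub_distrib]
          refine Finset.sum_le_sum fun j _ => ?_
          have := mul_le_mul_of_nonneg_left (le_max_left (x j - m * γ j) 0) (h0 i j)
          linarith
        · exact Finset.sum_nonneg fun j _ => mul_nonneg (h0 i j) (le_max_right _ _)
    _ = excess γ x m := by
        rw [Finset.sum_comm]
        simp only [← Finset.sum_mul, h1, one_mul, excess]

lemma excess_le_of_mem_futureCone (h : y ∈ futureCone γ x) (m : ℝ) :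
    excess γ y m ≤ excess γ x m := by
  obtain ⟨Λ, hΛ, rfl⟩ := h
  exact excess_mulVec_le hΛ m

lemma convex_gibbsPreserving : Convex ℝ (gibbsPreserving γ) := by
  intro A hA B hB a b ha hb hab
  refine ⟨Matrix.convex_colStochastic hA.1 hB.1 ha hb hab, ?_⟩
  rw [Matrix.add_mulVec, Matrix.smul_mulVec, Matrix.smul_mulVec, hA.2, hB.2, ← add_smul, hab,
    one_smul]

lemma convex_futureCone : Convex ℝ (futureCone γ x) := by
  rintro _ ⟨A, hA, rfl⟩ _ ⟨B, hB, rfl⟩ a b ha hb hab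
  refine ⟨a • A + b • B, convex_gibbsPreserving hA hB ha hb hab, ?_⟩
  rw [Matrix.add_mulVec, Matrix.smul_mulVec, Matrix.smul_mulVec]

lemma isCompact_gibbsPreserving : IsCompact (gibbsPreserving γ) := by
  have hK : IsCompact (Set.univ.pi fun _ : Fin d => Set.univ.pi fun _ : Fin d => Set.Icc (0 : ℝ) 1) :=
    isCompact_univ_pi fun _ => isCompact_univ_pi fun _ => isCompact_Icc
  refine hK.of_isClosed_subset ?_ ?_
  · have : gibbsPreserving γ = {Λ : Matrix (Fin d) (Fin d) ℝ | (∀ i j, 0 ≤ Λ i j) ∧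
        (∀ j, ∑ i, Λ i j = 1) ∧ ∀ i, ∑ j, Λ i j * γ j = γ i} :=
      Set.ext fun Λ => mem_gibbsPreserving
    rw [this]
    simp only [Set.ofPred_and, Set.ofPred_forall]
    refine (isClosed_iInter fun i => isClosed_iInter fun j => isClosed_le (by fun_prop) (by fun_prop)).inter
      ((isClosed_iInter fun i => isClosed_eq (by fun_prop) (by fun_prop)).inter
        (isClosed_iInter fun i => isClosed_eq (by fun_prop) (by fun_prop)))
  · intro Λ hΛ i _ j _
    exact ⟨Matrix.nonneg_of_mem_colStochastic hΛ.1, Matrix.le_one_of_mem_colStochastic hΛ.1⟩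

lemma isCompact_futureCone : IsCompact (futureCone γ x) := by
  have : futureCone γ x = (fun Λ : Matrix (Fin d) (Fin d) ℝ => Λ *ᵥ x) '' gibbsPreserving γ := rfl
  rw [this]
  exact isCompact_gibbsPreserving.image (by fun_prop)

end GibbsPreserving

/-! ### Partial sums in a given order -/

section PartialSum

lemma perm_inv_apply_self {α : Type*} (σ : Equiv.Perm α) (a : α) : σ⁻¹ (σ a) = a :=
  σ.symm_apply_apply a

lemma perm_apply_inv_self {α : Type*} (σ : Equiv.Perm α) (a : α) : σ (σ⁻¹ a) = a :=
  σ.apply_symm_apply a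

variable {d : ℕ}

/-- The sum of the first `k` entries of `v`. -/
def partialSum (v : Fin d → ℝ) (k : ℕ) : ℝ :=
  ∑ i with i.val < k, v i

lemma partialSum_zero (v : Fin d → ℝ) : partialSum v 0 = 0 := by
  simp [partialSum]

lemma partialSum_card (v : Fin d → ℝ) : partialSum v d = ∑ i, v i := by
  simp [partialSum]

lemma partialSum_succ (v : Fin d → ℝ) (k : Fin d) :
    partialSum v (k + 1) = partialSum v k + v k := by
  have : (Finset.univ.filter fun i : Fin d => i.val < k.val + 1) =
      insert k (Finset.univ.filter fun i : Fin d => i.val < k.val) := by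
    ext i
    simp only [Finset.mem_filter, Finset.mem_univ, true_and, Finset.mem_insert, Fin.ext_iff]
    omega
  rw [partialSum, this, Finset.sum_insert (by simp), add_comm, partialSum]

lemma monotone_partialSum {v : Fin d → ℝ} (hv : ∀ i, 0 ≤ v i) : Monotone (partialSum v) := by
  intro a b hab
  refine Finset.sum_le_sum_of_subset_of_nonneg ?_ fun i _ _ => hv i
  intro i
  simp only [Finset.mem_filter, Finset.mem_univ, true_and]
  omega

lemma partialSum_nonneg {v : Fin d → ℝ} (hv : ∀ i, 0 ≤ v i) (k : ℕ) : 0 ≤ partialSum v k :=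
  Finset.sum_nonneg fun i _ => hv i

lemma partialSum_le_sum {v : Fin d → ℝ} (hv : ∀ i, 0 ≤ v i) (k : ℕ) :
    partialSum v k ≤ ∑ i, v i :=
  Finset.sum_le_sum_of_subset_of_nonneg (Finset.filter_subset _ _) fun i _ _ => hv i

lemma sum_telescope (D : ℕ → ℝ) : ∑ k : Fin d, (D (k + 1) - D k) = D d - D 0 := by
  rw [Fin.sum_univ_eq_sum_range (fun k => D (k + 1) - D k) d, Finset.sum_range_sub]

/-- Summation by parts for a non-increasing sequence of weights. -/
lemma sum_mul_telescope_nonneg {w : Fin d → ℝ} (hw : Antitone w) {D : ℕ → ℝ} (h0 : D 0 = 0)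
    (hd : D d = 0) (hD : ∀ k, k ≤ d → 0 ≤ D k) : 0 ≤ ∑ k : Fin d, w k * (D (k + 1) - D k) := by
  obtain _ | n := d
  · simp
  -- The index is clamped to make `w` a total sequence; only indices up to `n` are used in the end.
  let v : ℕ → ℝ := fun k => w ⟨min k n, by omega⟩
  have hv : ∀ k, v (k + 1) ≤ v k := fun k => hw (by simp only [Fin.mk_le_mk]; omega)
  have key : ∀ k, k ≤ n → v k * D (k + 1) ≤ ∑ i ∈ Finset.range (k + 1), v i * (D (i + 1) - D i) := by
    intro k
    induction k with
    | zero => simp [h0]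
    | succ k ih =>
      intro hk
      rw [Finset.sum_range_succ]
      have := ih (by omega)
      have := mul_le_mul_of_nonneg_right (hv k) (hD (k + 1) (by omega))
      linarith
  have h := key n le_rfl
  rw [hd, mul_zero, ← Fin.sum_univ_eq_sum_range (fun i => v i * (D (i + 1) - D i))] at h
  refine h.trans (le_of_eq (Finset.sum_congr rfl fun k _ => ?_))
  have : v k = w k := by
    simp only [v]
    congr 1
    ext
    simp
    omega
  rw [this]

lemma exists_perm_antitone (w : Fin d → ℝ) : ∃ ρ : Equiv.Perm (Fin d), Antitone (reorder ρ w) := by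
  refine ⟨(Tuple.sort fun i => -w i)⁻¹, fun i j hij => ?_⟩
  have := Tuple.monotone_sort (fun i => -w i) hij
  simpa [reorder] using this

lemma sum_reorder (σ : Equiv.Perm (Fin d)) (x : Fin d → ℝ) : ∑ i, reorder σ x i = ∑ i, x i :=
  Equiv.sum_comp σ⁻¹ x

lemma exists_betaOrdering (γ x : Fin d → ℝ) : ∃ σ, IsBetaOrdering γ x σ :=
  exists_perm_antitone fun i => x i / γ i

lemma excess_reorder (σ : Equiv.Perm (Fin d)) (γ x : Fin d → ℝ) (m : ℝ) :
    excess (reorder σ γ) (reorder σ x) m = excess γ x m :=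
  sum_reorder σ fun i => max (x i - m * γ i) 0

lemma partialSum_sub_le_excess (σ : Equiv.Perm (Fin d)) (γ x : Fin d → ℝ) (m : ℝ) (k : ℕ) :
    partialSum (reorder σ x) k - m * partialSum (reorder σ γ) k ≤ excess γ x m := by
  rw [← excess_reorder σ]
  have := sum_mul_sub_le_excess (γ := reorder σ γ) (x := reorder σ x) (m := m)
    (b := fun i => if i.val < k then 1 else 0) (fun i => by split_ifs <;> norm_num)
    (fun i => by split_ifs <;> norm_num)
  simpa [partialSum, Finset.sum_filter] using this

end PartialSum

/-! ### Thermomajorisation suffices, by comonotone coupling and separation -/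

section Comonotone

variable {d : ℕ} {γ x y : Fin d → ℝ}

/-- Supermodularity of `min`, which makes the coupling below nonnegative. -/
lemma min_sub_min_mono {a b s t : ℝ} (hab : a ≤ b) (hst : s ≤ t) :
    min s b - min s a ≤ min t b - min t a := by
  rcases le_total s a with h1 | h1 <;> rcases le_total s b with h2 | h2 <;>
    rcases le_total t a with h3 | h3 <;> rcases le_total t b with h4 | h4 <;>
    simp only [min_eq_left, min_eq_right, h1, h2, h3, h4] <;> linarith

/-- The sum is the thermomajorisation curve of `x` at abscissa `s`. The curve is concave, so the
slope of a segment containing `s` gives a supporting line there. -/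
lemma exists_sum_cut_eq_excess (hγ : ∀ i, 0 < γ i) {σ : Equiv.Perm (Fin d)}
    (hσ : IsBetaOrdering γ x σ) {s : ℝ} (hs0 : 0 ≤ s) (hs1 : s ≤ ∑ i, γ i) :
    ∃ m, ∑ l : Fin d, (min s (partialSum (reorder σ γ) (l + 1)) -
      min s (partialSum (reorder σ γ) l)) * (x (σ⁻¹ l) / γ (σ⁻¹ l)) - m * s = excess γ x m := by
  obtain _ | n := d
  · have : s = 0 := le_antisymm (by simpa using hs1) hs0
    exact ⟨0, by simp [excess]⟩
  set H := partialSum (reorder σ γ) with hH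
  have hmono : Monotone H := monotone_partialSum fun i => (hγ _).le
  have hH0 : H 0 = 0 := partialSum_zero _
  have hH1 : H (n + 1) = ∑ i, γ i := by rw [hH, partialSum_card, sum_reorder]
  -- The last elbow not beyond `s`, capped at `n` so that it still starts a segment when `s` is the
  -- full length.
  obtain ⟨k, hkn, hk, hgt⟩ : ∃ k, k ≤ n ∧ H k ≤ s ∧ ∀ l, k < l → l ≤ n → s ≤ H l := by
    classical
    refine ⟨Nat.findGreatest (fun l => H l ≤ s) n, Nat.findGreatest_le n, ?_, fun l h1 h2 => ?_⟩
    · exact Nat.findGreatest_spec (P := fun l => H l ≤ s) (Nat.zero_le n) (by rw [hH0]; exact hs0)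
    · exact (not_le.1 (Nat.findGreatest_is_greatest (P := fun l => H l ≤ s) h1 h2)).le
  let z : Fin (n + 1) → ℝ := fun l => x (σ⁻¹ l) / γ (σ⁻¹ l)
  have hz : Antitone z := hσ
  let K : Fin (n + 1) := ⟨k, by omega⟩
  refine ⟨z K, ?_⟩
  have hcut : ∑ l : Fin (n + 1), (min s (H (l + 1)) - min s (H l)) = s := by
    rw [sum_telescope fun l => min s (H l), hH0, hH1, min_eq_left hs1, min_eq_right hs0, sub_zero]
  rw [← excess_reorder σ]
  have hms : z K * s = z K * ∑ l : Fin (n + 1), (min s (H (l + 1)) - min s (H l)) := by rw [hcut]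
  rw [hms, Finset.mul_sum, ← Finset.sum_sub_distrib]
  refine Finset.sum_congr rfl fun l _ => ?_
  have hγl : 0 < γ (σ⁻¹ l) := hγ _
  have hsucc : H (l + 1) = H l + γ (σ⁻¹ l) := partialSum_succ (reorder σ γ) l
  have hx : x (σ⁻¹ l) = z l * γ (σ⁻¹ l) := (div_mul_cancel₀ _ hγl.ne').symm
  change (min s (H (l + 1)) - min s (H l)) * z l - z K * _ =
    max (x (σ⁻¹ l) - z K * γ (σ⁻¹ l)) 0
  rcases lt_trichotomy l.val k with h | h | h
  · have h1 : H (l + 1) ≤ s := (hmono h).trans hk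
    have h2 : z K ≤ z l := hz (Fin.mk_le_mk.2 h.le)
    rw [min_eq_right h1, min_eq_right (by linarith), max_eq_left, hsucc, hx]
    · ring
    · rw [hx]; nlinarith
  · have : l = K := Fin.ext h
    rw [hx, this, sub_self, max_self]
    ring
  · have h1 : s ≤ H l := hgt l h (by omega)
    have h2 : z l ≤ z K := hz (Fin.mk_le_mk.2 h.le)
    rw [min_eq_left h1, min_eq_left (by linarith), max_eq_right]
    · ring
    · rw [hx]; nlinarith

/-- The comonotone coupling of `x` with a weight vector `w` does at least as well on `w` as every
vector that `x` thermomajorises. -/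
lemma exists_gibbsPreserving_dotProduct_le (hγ : ∀ i, 0 < γ i) (hsum : ∑ i, y i = ∑ i, x i)
    (h : ∀ m, excess γ y m ≤ excess γ x m) (w : Fin d → ℝ) :
    ∃ Λ ∈ gibbsPreserving γ, ∑ i, w i * y i ≤ ∑ i, w i * (Λ *ᵥ x) i := by
  obtain ⟨σ, hσ⟩ := exists_betaOrdering γ x
  obtain ⟨ρ, hρ⟩ := exists_perm_antitone w
  set G := partialSum (reorder ρ γ) with hG
  set H := partialSum (reorder σ γ) with hH
  have hGm : Monotone G := monotone_partialSum fun i => (hγ _).le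
  have hHm : Monotone H := monotone_partialSum fun i => (hγ _).le
  have hG0 : G 0 = 0 := partialSum_zero _
  have hH0 : H 0 = 0 := partialSum_zero _
  have hG1 : G d = ∑ i, γ i := by rw [hG, partialSum_card, sum_reorder]
  have hH1 : H d = ∑ i, γ i := by rw [hH, partialSum_card, sum_reorder]
  have hGn : ∀ k, 0 ≤ G k := partialSum_nonneg fun i => (hγ _).le
  have hHn : ∀ k, 0 ≤ H k := partialSum_nonneg fun i => (hγ _).le
  have hGs : ∀ k : Fin d, G (k + 1) = G k + γ (ρ⁻¹ k) := partialSum_succ (reorder ρ γ)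
  have hHs : ∀ k : Fin d, H (k + 1) = H k + γ (σ⁻¹ k) := partialSum_succ (reorder σ γ)
  have hGle : ∀ k, G k ≤ ∑ i, γ i := fun k => by
    simpa only [sum_reorder] using partialSum_le_sum (v := reorder ρ γ) (fun i => (hγ _).le) k
  have hHle : ∀ k, H k ≤ ∑ i, γ i := fun k => by
    simpa only [sum_reorder] using partialSum_le_sum (v := reorder σ γ) (fun i => (hγ _).le) k
  -- The length of the overlap of the intervals `[G k, G (k + 1)]` and `[H l, H (l + 1)]`, from the
  -- subdivisions of `[0, ∑ γ]` in the orders of `w` and of `x`.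
  let M : Fin d → Fin d → ℝ := fun k l =>
    (min (G (k + 1)) (H (l + 1)) - min (G (k + 1)) (H l)) - (min (G k) (H (l + 1)) - min (G k) (H l))
  have hM : ∀ k l, 0 ≤ M k l := fun k l =>
    sub_nonneg.2 (min_sub_min_mono (hHm (Nat.le_succ _)) (hGm (Nat.le_succ _)))
  have hrow : ∀ k, ∑ l, M k l = γ (ρ⁻¹ k) := by
    intro k
    simp only [M]
    rw [Finset.sum_sub_distrib, sum_telescope fun l => min (G (k + 1)) (H l),
      sum_telescope fun l => min (G k) (H l), hH0, hH1, min_eq_left (hGle _), min_eq_left (hGle _),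
      min_eq_right (hGn _), min_eq_right (hGn _), hGs]
    ring
  have hcol : ∀ l, ∑ k, M k l = γ (σ⁻¹ l) := by
    intro l
    simp only [M]
    rw [sum_telescope fun k => min (G k) (H (l + 1)) - min (G k) (H l), hG0, hG1,
      min_eq_right (hHle _), min_eq_right (hHle _), min_eq_left (hHn _), min_eq_left (hHn _), hHs]
    ring
  let Λ : Matrix (Fin d) (Fin d) ℝ := Matrix.of fun i j => M (ρ i) (σ j) / γ j
  have hΛ : Λ ∈ gibbsPreserving γ := by
    refine mem_gibbsPreserving.2 ⟨fun i j => div_nonneg (hM _ _) (hγ j).le, fun j => ?_, fun i => ?_⟩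
    · simp only [Λ, Matrix.of_apply]
      rw [← Finset.sum_div, Equiv.sum_comp ρ fun k => M k (σ j), hcol, perm_inv_apply_self,
        div_self (hγ j).ne']
    · simp only [Λ, Matrix.of_apply, div_mul_cancel₀ _ (hγ _).ne']
      rw [Equiv.sum_comp σ fun l => M (ρ i) l, hrow, perm_inv_apply_self]
  -- The curve of `x`; its increments over the intervals of `G` are the entries of `Λ x` in the
  -- order `ρ`.
  let F : ℝ → ℝ := fun s => ∑ l : Fin d, (min s (H (l + 1)) - min s (H l)) *
    (x (σ⁻¹ l) / γ (σ⁻¹ l))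
  have hΛF : ∀ k : Fin d, (Λ *ᵥ x) (ρ⁻¹ k) = F (G (k + 1)) - F (G k) := by
    intro k
    simp only [F, ← Finset.sum_sub_distrib, ← sub_mul, Matrix.mulVec, dotProduct, Λ,
      Matrix.of_apply, perm_apply_inv_self]
    rw [← Equiv.sum_comp σ⁻¹]
    refine Finset.sum_congr rfl fun l _ => ?_
    rw [perm_apply_inv_self, div_mul_eq_mul_div, mul_div_assoc]
  have hF0 : F 0 = 0 := Finset.sum_eq_zero fun l _ => by
    rw [min_eq_left (hHn _), min_eq_left (hHn _), sub_self, zero_mul]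
  have hF1 : F (∑ i, γ i) = ∑ i, x i := by
    rw [← sum_reorder σ x]
    refine Finset.sum_congr rfl fun l _ => ?_
    rw [min_eq_right (hHle _), min_eq_right (hHle _), hHs, add_sub_cancel_left,
      mul_div_cancel₀ _ (hγ _).ne', reorder]
  refine ⟨Λ, hΛ, ?_⟩
  rw [← sub_nonneg, ← Finset.sum_sub_distrib, ← Equiv.sum_comp ρ⁻¹]
  -- The gap `D` is nonnegative: the supporting line to the curve of `x` at `G k` also bounds the
  -- partial sums of `y`.
  have key := sum_mul_telescope_nonneg hρ (D := fun k => F (G k) - partialSum (reorder ρ y) k)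
    (by simp [hG0, hF0, partialSum_zero])
    (by simp [hG1, hF1, partialSum_card, sum_reorder, hsum])
    (fun k _ => by
      obtain ⟨m, hm⟩ := exists_sum_cut_eq_excess hγ hσ (hGn k) (hGle k)
      have h1 := partialSum_sub_le_excess ρ γ y m k
      have h2 := h m
      have h3 : F (G k) - m * G k = excess γ x m := hm
      simp only [← hG] at h1
      linarith)
  refine key.trans (le_of_eq (Finset.sum_congr rfl fun k _ => ?_))
  rw [hΛF, partialSum_succ]
  simp only [reorder]
  ring

/-- Thermomajorisation, expressed by the excess, is sufficient for a conversion by a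
Gibbs-preserving matrix. -/
theorem mem_futureCone_of_excess_le (hγ : ∀ i, 0 < γ i) (hsum : ∑ i, y i = ∑ i, x i)
    (h : ∀ m, excess γ y m ≤ excess γ x m) : y ∈ futureCone γ x := by
  by_contra hy
  obtain ⟨f, u, hf, hu⟩ :=
    geometric_hahn_banach_closed_point convex_futureCone isCompact_futureCone.isClosed hy
  have hfv : ∀ v : Fin d → ℝ, f v = ∑ i, f (Pi.single i 1) * v i := by
    intro v
    conv_lhs => rw [pi_eq_sum_univ' v]
    simp only [map_sum, map_smul, smul_eq_mul, mul_comm]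
  obtain ⟨Λ, hΛ, hle⟩ := exists_gibbsPreserving_dotProduct_le hγ hsum h fun i => f (Pi.single i 1)
  rw [← hfv, ← hfv] at hle
  have := hf _ ⟨Λ, hΛ, rfl⟩
  linarith

end Comonotone

/-! ### Tangent vectors and their future cones -/

section Tangent

variable {d : ℕ} {γ p q x : Fin d → ℝ} {m c : ℝ} {a b : Fin d} {σ : Equiv.Perm (Fin d)}

/-- The vector whose thermomajorisation curve, in an order beginning with `a` and ending with `b`,
follows the line of slope `m` and intercept `c` between its first and its last elbow. -/
def tangentPoint (γ : Fin d → ℝ) (m c : ℝ) (a b : Fin d) : Fin d → ℝ :=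
  fun j => m * γ j + (if j = a then c else 0) - (if j = b then c + m - 1 else 0)

lemma sum_tangentPoint (hγ1 : ∑ i, γ i = 1) : ∑ j, tangentPoint γ m c a b j = 1 := by
  simp only [tangentPoint, Finset.sum_sub_distrib, Finset.sum_add_distrib, ← Finset.mul_sum, hγ1,
    Finset.sum_ite_eq', Finset.mem_univ, if_true]
  ring

lemma tangentPoint_add {s t m' c' : ℝ} (hst : s + t = 1) :
    tangentPoint γ (s * m + t * m') (s * c + t * c') a b =
      s • tangentPoint γ m c a b + t • tangentPoint γ m' c' a b := by
  obtain rfl : t = 1 - s := by linarith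
  ext j
  simp only [tangentPoint, Pi.add_apply, Pi.smul_apply, smul_eq_mul]
  split_ifs <;> ring

/-- Since `c + m - 1 ≥ 0`, only the entry at `a` can exceed `m * γ`, and by at most `c`. -/
lemma excess_tangentPoint_le (hc : 0 ≤ c) (hcm : 1 - m ≤ c) :
    excess γ (tangentPoint γ m c a b) m ≤ c := by
  calc excess γ (tangentPoint γ m c a b) m ≤ ∑ j, if j = a then c else 0 := by
        refine Finset.sum_le_sum fun j _ => ?_
        simp only [tangentPoint]
        refine max_le ?_ ?_ <;> split_ifs <;> linarith
    _ = c := by simp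

/-- A vector whose thermomajorisation curve lies below the line of slope `m` and intercept `c` is
in the future thermal cone of the tangent point with the same first and last index. -/
lemma mem_futureCone_tangentPoint (hγ : ∀ i, 0 < γ i) (hγ1 : ∑ i, γ i = 1) (hq1 : ∑ i, q i = 1)
    (hab : a ≠ b) (ha : ∀ j, q j / γ j ≤ q a / γ a) (hb : ∀ j, q b / γ b ≤ q j / γ j)
    (hc : excess γ q m ≤ c) : q ∈ futureCone γ (tangentPoint γ m c a b) := by
  refine mem_futureCone_of_excess_le hγ (hq1.trans (sum_tangentPoint hγ1).symm) fun m' => ?_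
  rcases le_total m m' with hm | hm
  -- Above `m`, the excess of `q` falls at rate at least `γ a` until it vanishes, while the entry at
  -- `a` alone keeps that of the tangent point at `c - (m' - m) * γ a` or more.
  · rcases le_or_gt (q a) (m' * γ a) with h | h
    · have : excess γ q m' = 0 := Finset.sum_eq_zero fun j _ => by
        refine max_eq_right ?_
        have h1 := (ha j).trans ((div_le_iff₀ (hγ a)).2 h)
        rw [div_le_iff₀ (hγ j)] at h1
        linarith
      rw [this]
      exact excess_nonneg
    · have h1 : excess γ q m' ≤ excess γ q m - (m' - m) * γ a := by
        have : (m' - m) * γ a = ∑ j, if j = a then (m' - m) * γ a else 0 := by simp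
        rw [this, excess, excess, ← Finset.sum_sub_distrib]
        refine Finset.sum_le_sum fun j _ => ?_
        have hj := mul_le_mul_of_nonneg_right hm (hγ j).le
        split_ifs with hja
        · subst hja
          rw [max_eq_left (by linarith), max_eq_left (by linarith)]
          linarith
        · rw [sub_zero]
          exact max_le_max_right _ (by linarith)
      have h2 : c + m * γ a - m' * γ a ≤ excess γ (tangentPoint γ m c a b) m' := by
        refine le_trans ?_ (Finset.single_le_sum
          (f := fun j => max (tangentPoint γ m c a b j - m' * γ j) 0)
          (fun j _ => le_max_right _ _) (Finset.mem_univ a))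
        refine le_trans (le_of_eq ?_) (le_max_left _ _)
        simp only [tangentPoint, if_true, if_neg hab]
        ring
      linarith
  -- Below `m`, the mirrored argument compares deficits, with `b` in the role of `a`.
  · have hqm := excess_eq_add_deficit (γ := γ) (x := q) (m := m)
    rw [excess_eq_add_deficit, excess_eq_add_deficit, sum_tangentPoint hγ1, hq1, hγ1]
    rw [hq1, hγ1] at hqm
    rcases le_or_gt (m' * γ b) (q b) with h | h
    · have : ∑ j, max (m' * γ j - q j) 0 = 0 := Finset.sum_eq_zero fun j _ => by
        refine max_eq_right ?_
        have h1 := ((le_div_iff₀ (hγ b)).2 h).trans (hb j)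
        rw [le_div_iff₀ (hγ j)] at h1
        linarith
      rw [this]
      have : 0 ≤ ∑ j, max (m' * γ j - tangentPoint γ m c a b j) 0 :=
        Finset.sum_nonneg fun _ _ => le_max_right _ _
      linarith
    · have h1 : ∑ j, max (m' * γ j - q j) 0 ≤ ∑ j, max (m * γ j - q j) 0 - (m - m') * γ b := by
        have : (m - m') * γ b = ∑ j, if j = b then (m - m') * γ b else 0 := by simp
        rw [this, ← Finset.sum_sub_distrib]
        refine Finset.sum_le_sum fun j _ => ?_
        have hj := mul_le_mul_of_nonneg_right hm (hγ j).le
        split_ifs with hjb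
        · subst hjb
          rw [max_eq_left (by linarith), max_eq_left (by linarith)]
          linarith
        · rw [sub_zero]
          exact max_le_max_right _ (by linarith)
      have h2 : m' * γ b - m * γ b + (c + m - 1) ≤
          ∑ j, max (m' * γ j - tangentPoint γ m c a b j) 0 := by
        refine le_trans ?_ (Finset.single_le_sum
          (f := fun j => max (m' * γ j - tangentPoint γ m c a b j) 0)
          (fun j _ => le_max_right _ _) (Finset.mem_univ b))
        refine le_trans (le_of_eq ?_) (le_max_left _ _)
        simp only [tangentPoint, if_true, if_neg hab.symm]
        ring
      linarith

lemma sum_Iic_eq_partialSum (v : Fin d → ℝ) (n : Fin d) :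
    ∑ i ∈ Finset.Iic n, v i = partialSum v (n + 1) := by
  have h : Finset.Iic n = Finset.univ.filter fun i : Fin d => i.val < n.val + 1 :=
    Finset.ext fun i => by
      rw [Finset.mem_Iic, Finset.mem_filter, Fin.le_def, Nat.lt_succ_iff]
      exact ⟨fun h => ⟨Finset.mem_univ i, h⟩, fun h => h.2⟩
  rw [h, partialSum]

lemma sum_middle (hd : 1 < d) (v : Fin d → ℝ) :
    ∑ i : Fin d with 0 < i.val ∧ i.val + 1 < d, v i =
      ∑ i, v i - v ⟨0, by omega⟩ - v ⟨d - 1, by omega⟩ := by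
  rw [Finset.sum_filter]
  have h0 : v ⟨0, by omega⟩ = ∑ i : Fin d, if i = ⟨0, by omega⟩ then v i else 0 := by simp
  have h1 : v ⟨d - 1, by omega⟩ = ∑ i : Fin d, if i = ⟨d - 1, by omega⟩ then v i else 0 := by simp
  rw [h0, h1, ← Finset.sum_sub_distrib, ← Finset.sum_sub_distrib]
  refine Finset.sum_congr rfl fun i _ => ?_
  have := i.isLt
  simp only [Fin.ext_iff]
  split_ifs <;> first | omega | ring

/-- As `γ` has total one, the middle positions contribute `m * (1 - γ a - γ b)`; normalisation then
forces the last entry to be `m * γ b - (c + m - 1)`. -/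
lemma tangentVector_eq_tangentPoint (hd : 1 < d) (hγ1 : ∑ i, γ i = 1) (n : Fin d)
    (π : Equiv.Perm (Fin d)) :
    tangentVector γ p σ n π = tangentPoint γ (tangentSlope γ p σ n)
      (partialSum (reorder σ p) (n + 1) -
        tangentSlope γ p σ n * partialSum (reorder σ γ) (n + 1))
      (π ⟨0, by omega⟩) (π ⟨d - 1, by omega⟩) := by
  funext j
  obtain ⟨k, rfl⟩ := π.surjective j
  have hk := k.isLt
  simp only [tangentVector, perm_inv_apply_self, tangentOrdered, tangentPoint, tangentLast,
    tangentFirst, sum_Iic_eq_partialSum, π.injective.eq_iff, Fin.ext_iff]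
  rw [sum_middle hd fun i => γ (π i), Equiv.sum_comp π γ, hγ1]
  split_ifs with h1 h2 h3 h4 h5 <;> try omega
  · have : k = ⟨0, by omega⟩ := Fin.ext h1
    rw [this]; ring
  · have : k = ⟨d - 1, by omega⟩ := Fin.ext (by simp only []; omega)
    rw [this]; ring
  · ring

/-- The conjugate of the thermomajorisation curve between the slopes of two consecutive segments. -/
lemma excess_eq_partialSum (hγ : ∀ i, 0 < γ i) {k : ℕ}
    (h1 : ∀ i : Fin d, i.val < k → m ≤ tangentSlope γ p σ i)
    (h2 : ∀ i : Fin d, k ≤ i.val → tangentSlope γ p σ i ≤ m) :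
    excess γ p m = partialSum (reorder σ p) k - m * partialSum (reorder σ γ) k := by
  rw [← excess_reorder σ, excess, partialSum, partialSum, Finset.mul_sum,
    ← Finset.sum_sub_distrib, Finset.sum_filter]
  refine Finset.sum_congr rfl fun i _ => ?_
  have hi : 0 < reorder σ γ i := hγ _
  split_ifs with h
  · have := h1 i h
    rw [tangentSlope, le_div_iff₀ hi] at this
    exact max_eq_left (by linarith)
  · have := h2 i (not_lt.1 h)
    rw [tangentSlope, div_le_iff₀ hi] at this
    exact max_eq_right (by linarith)

lemma IsBetaOrdering.antitone_tangentSlope (hσ : IsBetaOrdering γ p σ) :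
    Antitone (tangentSlope γ p σ) := hσ

/-- Two consecutive tangents meet at an elbow of the thermomajorisation curve. -/
lemma intercept_eq_excess (hγ : ∀ i, 0 < γ i) (hσ : IsBetaOrdering γ p σ) {n : Fin d} {k : ℕ}
    (h1 : n.val ≤ k) (h2 : k ≤ n.val + 1) :
    excess γ p (tangentSlope γ p σ n) = partialSum (reorder σ p) k -
      tangentSlope γ p σ n * partialSum (reorder σ γ) k := by
  refine excess_eq_partialSum hγ (fun i hi => hσ.antitone_tangentSlope ?_)
    (fun i hi => hσ.antitone_tangentSlope ?_) <;> rw [Fin.le_def] <;> omega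

lemma tangentVector_eq (hd : 1 < d) (hγ : ∀ i, 0 < γ i) (hγ1 : ∑ i, γ i = 1)
    (hσ : IsBetaOrdering γ p σ) (n : Fin d) (π : Equiv.Perm (Fin d)) :
    tangentVector γ p σ n π = tangentPoint γ (tangentSlope γ p σ n)
      (excess γ p (tangentSlope γ p σ n)) (π ⟨0, by omega⟩) (π ⟨d - 1, by omega⟩) := by
  rw [tangentVector_eq_tangentPoint hd hγ1, intercept_eq_excess hγ hσ (Nat.le_succ _) le_rfl]

end Tangent

/-! ### The tangent region and its interior -/

section Region

variable {d : ℕ} {γ p q x : Fin d → ℝ} {m : ℝ} {σ : Equiv.Perm (Fin d)}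

/-- A slope at which the conjugate curve of `p` exceeds that of another normalised vector lies
between the slopes of two consecutive segments of the curve of `p`. -/
lemma exists_slope_between (hγ : ∀ i, 0 < γ i) (hγ1 : ∑ i, γ i = 1) (hp1 : ∑ i, p i = 1)
    (hσ : IsBetaOrdering γ p σ) (hq1 : ∑ i, q i = 1) (h : excess γ q m < excess γ p m) :
    ∃ (i : ℕ) (hi : i + 1 < d), tangentSlope γ p σ ⟨i + 1, hi⟩ ≤ m ∧
      m ≤ tangentSlope γ p σ ⟨i, Nat.lt_of_succ_lt hi⟩ := by
  classical
  have hex : ∃ k, ∀ i : Fin d, k ≤ i.val → tangentSlope γ p σ i ≤ m :=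
    ⟨d, fun i hi => absurd i.isLt (by omega)⟩
  have hspec := Nat.find_spec hex
  have hmin : ∀ k < Nat.find hex, _ := fun k => Nat.find_min hex
  have hkd : Nat.find hex ≤ d := Nat.find_min' hex fun i hi => absurd i.isLt (by omega)
  generalize Nat.find hex = k at hspec hmin hkd
  -- For index zero, `m` is at least every slope, so the excess of `p` vanishes.
  obtain _ | k := k
  · rw [excess_eq_partialSum (σ := σ) (k := 0) hγ (fun i hi => absurd hi (Nat.not_lt_zero _)) hspec,
      partialSum_zero, partialSum_zero] at h
    have := excess_nonneg (γ := γ) (x := q) (m := m)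
    linarith
  have hk : m ≤ tangentSlope γ p σ ⟨k, hkd⟩ := by
    have := hmin k (Nat.lt_succ_self k)
    push Not at this
    obtain ⟨i, hi, him⟩ := this
    exact him.le.trans (hσ.antitone_tangentSlope hi)
  rcases hkd.lt_or_eq with hlt | heq
  · exact ⟨k, hlt, hspec _ le_rfl, hk⟩
  -- Here no slope is below `m`, so the excess of `p` is `1 - m`, a lower bound for every normalised
  -- vector.
  · rw [excess_eq_partialSum (σ := σ) (k := d) hγ
      (fun i hi => hk.trans (hσ.antitone_tangentSlope (Fin.le_def.2 (by simp only []; omega))))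
      (fun i hi => absurd i.isLt (by omega)), partialSum_card, partialSum_card, sum_reorder,
      sum_reorder, hp1, hγ1] at h
    have := sum_sub_le_excess (γ := γ) (x := q) (m := m)
    rw [hγ1, hq1] at this
    linarith

lemma mem_tangentRegion_of_excess_lt (hγ : ∀ i, 0 < γ i) (hγ1 : ∑ i, γ i = 1)
    (hp1 : ∑ i, p i = 1) (hσ : IsBetaOrdering γ p σ) (hq1 : ∑ i, q i = 1)
    (h : excess γ q m < excess γ p m) : q ∈ tangentRegion γ p σ := by
  obtain ⟨i, hi, hm1, hm0⟩ := exists_slope_between hγ hγ1 hp1 hσ hq1 h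
  have hd : 1 < d := by omega
  obtain ⟨τ, hτ⟩ := exists_betaOrdering γ q
  simp only [tangentRegion, Set.mem_iUnion]
  refine ⟨τ⁻¹, i, hi, ?_⟩
  rw [tangentVector_eq hd hγ hγ1 hσ, tangentVector_eq hd hγ hγ1 hσ]
  set z := tangentSlope γ p σ ⟨i, Nat.lt_of_succ_lt hi⟩ with hz
  set z' := tangentSlope γ p σ ⟨i + 1, hi⟩ with hz'
  set a := τ⁻¹ ⟨0, by omega⟩
  set b := τ⁻¹ ⟨d - 1, by omega⟩
  obtain ⟨s, t, hs, ht, hst, hm⟩ : m ∈ segment ℝ z z' := by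
    rw [segment_symm, segment_eq_Icc (hm1.trans hm0)]
    exact ⟨hm1, hm0⟩
  simp only [smul_eq_mul] at hm
  -- Between consecutive slopes the conjugate is affine: all these supporting lines pass through the
  -- common elbow.
  have hc : excess γ p m = s * excess γ p z + t * excess γ p z' := by
    rw [intercept_eq_excess (k := i + 1) hγ hσ (Nat.le_succ _) le_rfl,
      intercept_eq_excess (k := i + 1) hγ hσ le_rfl (Nat.le_succ _),
      excess_eq_partialSum (σ := σ) (k := i + 1) hγ
        (fun j hj => hm0.trans (hσ.antitone_tangentSlope (Fin.le_def.2 (Nat.lt_succ_iff.1 hj))))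
        (fun j hj => (hσ.antitone_tangentSlope (Fin.le_def.2 hj)).trans hm1)]
    rw [← hz, ← hz', ← hm]
    obtain rfl : t = 1 - s := by linarith
    ring
  have hab : a ≠ b := fun hab => by
    have := congrArg Fin.val ((τ⁻¹).injective hab)
    simp only [] at this
    omega
  have hfirst : ∀ j, q j / γ j ≤ q a / γ a := fun j => by
    have := hτ (a := ⟨0, by omega⟩) (b := τ j) (Fin.le_def.2 (Nat.zero_le _))
    simpa only [perm_inv_apply_self] using this
  have hlast : ∀ j, q b / γ b ≤ q j / γ j := fun j => by
    have := hτ (a := τ j) (b := ⟨d - 1, by omega⟩)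
      (Fin.le_def.2 (by have := (τ j).isLt; simp only []; omega))
    simpa only [perm_inv_apply_self] using this
  -- The same `Λ` acts on both tangent points, so linearity splits `q` into a convex combination of
  -- elements of the two cones.
  obtain ⟨Λ, hΛ, rfl⟩ := mem_futureCone_tangentPoint hγ hγ1 hq1 hab hfirst hlast h.le
  rw [hc, ← hm, tangentPoint_add hst, Matrix.mulVec_add, Matrix.mulVec_smul, Matrix.mulVec_smul]
  refine convex_convexHull ℝ _ ?_ ?_ hs ht hst
  · exact subset_convexHull ℝ _ (Or.inl ⟨Λ, hΛ, rfl⟩)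
  · exact subset_convexHull ℝ _ (Or.inr ⟨Λ, hΛ, rfl⟩)

lemma mem_quasiInterior_of_excess_lt (hγ : ∀ i, 0 < γ i) (hγ1 : ∑ i, γ i = 1)
    (hp1 : ∑ i, p i = 1) (hσ : IsBetaOrdering γ p σ) (hq1 : ∑ i, q i = 1)
    (h : excess γ q m < excess γ p m) : q ∈ quasiInterior (tangentRegion γ p σ) := by
  refine ⟨⟨q, hq1⟩, ?_, rfl⟩
  refine interior_maximal
    (s := {x : quasiSimplex d | (x : Fin d → ℝ) ∈ tangentRegion γ p σ})
    (t := {x : quasiSimplex d | excess γ (x : Fin d → ℝ) m < excess γ p m})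
    (fun x hx => mem_tangentRegion_of_excess_lt hγ hγ1 hp1 hσ x.2 hx)
    (isOpen_lt (continuous_excess.comp continuous_subtype_val) continuous_const) h

/-- The thermomajorisation curves of the elements of the tangent region do not exceed the curve of
`p` at one of its inner elbows. -/
lemma exists_elbow_of_mem_tangentRegion (hγ : ∀ i, 0 < γ i) (hγ1 : ∑ i, γ i = 1)
    (hp1 : ∑ i, p i = 1) (hσ : IsBetaOrdering γ p σ) (hx : x ∈ tangentRegion γ p σ) :
    ∃ k, 0 < k ∧ k < d ∧ ∀ b : Fin d → ℝ, (∀ j, 0 ≤ b j) → (∀ j, b j ≤ 1) →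
      ∑ j, b j * γ j = partialSum (reorder σ γ) k →
        ∑ j, b j * x j ≤ partialSum (reorder σ p) k := by
  simp only [tangentRegion, Set.mem_iUnion] at hx
  obtain ⟨π, i, hi, hx⟩ := hx
  have hd : 1 < d := by omega
  refine ⟨i + 1, Nat.succ_pos i, hi, fun b hb0 hb1 hb => ?_⟩
  -- The bounds on `n` leave `i` and `i + 1`, whose tangents both pass through elbow `i + 1`.
  have hcone : ∀ n : Fin d, n.val ≤ i + 1 → i + 1 ≤ n.val + 1 →
      ∀ y ∈ futureCone γ (tangentVector γ p σ n π),
        ∑ j, b j * y j ≤ partialSum (reorder σ p) (i + 1) := by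
    intro n h1 h2 y hy
    have hle := excess_le_of_mem_futureCone hy (tangentSlope γ p σ n)
    have hone := sum_sub_le_excess (γ := γ) (x := p) (m := tangentSlope γ p σ n)
    rw [hγ1, hp1, mul_one] at hone
    rw [tangentVector_eq hd hγ hγ1 hσ] at hle
    have h3 := hle.trans (excess_tangentPoint_le excess_nonneg hone)
    rw [intercept_eq_excess hγ hσ h1 h2] at h3
    have h4 := sum_mul_sub_le_excess (γ := γ) (x := y) (m := tangentSlope γ p σ n) hb0 hb1
    rw [hb] at h4
    linarith
  have hconv : Convex ℝ {y : Fin d → ℝ | ∑ j, b j * y j ≤ partialSum (reorder σ p) (i + 1)} :=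
    convex_halfSpace_le (f := fun y : Fin d → ℝ => ∑ j, b j * y j)
      ⟨fun y z => by simp [mul_add, Finset.sum_add_distrib],
        fun c y => by simp [Finset.mul_sum, mul_left_comm]⟩ _
  exact convexHull_min (Set.union_subset (fun y hy => hcone _ (Nat.le_succ _) le_rfl y hy)
    (fun y hy => hcone _ le_rfl (Nat.le_succ _) y hy)) hconv hx

lemma gibbs_mem_futureCone (hγ : ∀ i, 0 < γ i) (hγ1 : ∑ i, γ i = 1) (hp1 : ∑ i, p i = 1) :
    γ ∈ futureCone γ p := by
  refine mem_futureCone_of_excess_le hγ (hγ1.trans hp1.symm) fun m => ?_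
  have h : excess γ γ m = max (1 - m) 0 := by
    have : ∀ i, max (γ i - m * γ i) 0 = γ i * max (1 - m) 0 := fun i => by
      rw [mul_max_of_nonneg _ _ (hγ i).le, mul_zero, mul_sub, mul_one, mul_comm m]
    simp only [excess, this, ← Finset.sum_mul, hγ1, one_mul]
  rw [h]
  refine max_le ?_ excess_nonneg
  have := sum_sub_le_excess (γ := γ) (x := p) (m := m)
  rwa [hγ1, hp1, mul_one] at this

/-- The thermomajorisation curve of a vector other than the Gibbs distribution lies strictly above
the diagonal in the open unit interval. -/
lemma exists_weight_gt (hγ : ∀ i, 0 < γ i) (hγ1 : ∑ i, γ i = 1) (hq1 : ∑ i, q i = 1)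
    (hq : q ≠ γ) {s : ℝ} (hs0 : 0 < s) (hs1 : s < 1) :
    ∃ b : Fin d → ℝ, (∀ j, 0 ≤ b j) ∧ (∀ j, b j ≤ 1) ∧ ∑ j, b j * γ j = s ∧
      s < ∑ j, b j * q j := by
  -- Perturbing the constant weight `s` along `r` leaves its pairing with `γ` unchanged and adds `δ
  -- * ∑ r ^ 2 * γ` to that with `q`.
  let r : Fin d → ℝ := fun j => (q j - γ j) / γ j
  have hrγ : ∀ j, r j * γ j = q j - γ j := fun j => div_mul_cancel₀ _ (hγ j).ne'
  have hRpos : 0 < 1 + ∑ j, |r j| := by positivity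
  have hmin : 0 < min s (1 - s) := lt_min hs0 (by linarith)
  -- Small enough to keep the weights `s + δ * r j` in `[0, 1]`.
  set δ := min s (1 - s) / (1 + ∑ j, |r j|) with hδ
  have hδ0 : 0 < δ := div_pos hmin hRpos
  have hδr : ∀ j, |δ * r j| ≤ min s (1 - s) := fun j => by
    have h1 : |r j| ≤ 1 + ∑ j, |r j| :=
      (Finset.single_le_sum (f := fun j => |r j|) (fun j _ => abs_nonneg _)
        (Finset.mem_univ j)).trans (by linarith)
    rw [abs_mul, abs_of_pos hδ0]
    calc δ * |r j| ≤ δ * (1 + ∑ j, |r j|) := mul_le_mul_of_nonneg_left h1 hδ0.le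
      _ = min s (1 - s) := div_mul_cancel₀ _ hRpos.ne'
  refine ⟨fun j => s + δ * r j, fun j => ?_, fun j => ?_, ?_, ?_⟩
  · have := (abs_le.1 (hδr j)).1
    have := min_le_left s (1 - s)
    linarith
  · have := (abs_le.1 (hδr j)).2
    have := min_le_right s (1 - s)
    linarith
  · simp only [add_mul, mul_assoc, hrγ, Finset.sum_add_distrib, ← Finset.mul_sum,
      Finset.sum_sub_distrib, hγ1, hq1]
    ring
  · obtain ⟨k, hk⟩ := Function.ne_iff.1 hq
    have hrk : r k ≠ 0 := div_ne_zero (sub_ne_zero.2 hk) (hγ k).ne'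
    have hpos : 0 < ∑ j, r j ^ 2 * γ j :=
      Finset.sum_pos' (fun j _ => mul_nonneg (sq_nonneg _) (hγ j).le)
        ⟨k, Finset.mem_univ k, mul_pos (by positivity) (hγ k)⟩
    have hqr : ∀ j, (s + δ * r j) * q j = s * q j + δ * (r j ^ 2 * γ j + (q j - γ j)) := fun j => by
      have : q j = r j * γ j + γ j := by rw [hrγ]; ring
      rw [← hrγ, this]
      ring
    simp only [hqr, Finset.sum_add_distrib, ← Finset.mul_sum, Finset.sum_sub_distrib, hq1, hγ1]
    have := mul_pos hδ0 hpos
    linarith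

lemma notMem_quasiInterior_of_mem_pastCone (hγ : ∀ i, 0 < γ i) (hγ1 : ∑ i, γ i = 1)
    (hp1 : ∑ i, p i = 1) (hσ : IsBetaOrdering γ p σ) (hq : q ∈ pastCone γ p)
    (hqp : q ∉ futureCone γ p) : q ∉ quasiInterior (tangentRegion γ p σ) := by
  rintro ⟨⟨q', hq1'⟩, hint, rfl⟩
  set q := q'
  have hq1 : ∑ i, q i = 1 := hq1'
  have hqγ : q ≠ γ := fun h => hqp (h.symm ▸ gibbs_mem_futureCone hγ hγ1 hp1 : q ∈ futureCone γ p)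
  -- The ray from `γ` through `q`, continued beyond `q` for positive `ε`.
  let φ : ℝ → quasiSimplex d := fun ε => ⟨fun i => q i + ε * (q i - γ i), by
    change ∑ i, (q i + ε * (q i - γ i)) = 1
    rw [Finset.sum_add_distrib, ← Finset.mul_sum, Finset.sum_sub_distrib, hq1, hγ1]
    ring⟩
  have hφ : Continuous φ := by
    refine Continuous.subtype_mk ?_ _
    fun_prop
  have hφ0 : φ 0 = ⟨q, hq1'⟩ := Subtype.ext (by funext i; simp [φ])
  have hnhds : ∀ᶠ ε in nhds (0 : ℝ), (φ ε : Fin d → ℝ) ∈ tangentRegion γ p σ := by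
    have : {x : quasiSimplex d | (x : Fin d → ℝ) ∈ tangentRegion γ p σ} ∈ nhds (φ 0) := by
      rw [hφ0]
      exact mem_interior_iff_mem_nhds.1 hint
    exact hφ.continuousAt this
  obtain ⟨ε, hmem, hε⟩ :=
    ((hnhds.filter_mono nhdsWithin_le_nhds).and (self_mem_nhdsWithin (s := Set.Ioi (0 : ℝ)))).exists
  have hε0 : 0 < ε := hε
  obtain ⟨k, hk0, hkd, hk⟩ := exists_elbow_of_mem_tangentRegion hγ hγ1 hp1 hσ hmem
  have hφb : ∀ b : Fin d → ℝ, ∑ j, b j * (φ ε : Fin d → ℝ) j =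
      (1 + ε) * ∑ j, b j * q j - ε * ∑ j, b j * γ j := fun b => by
    rw [Finset.mul_sum, Finset.mul_sum, ← Finset.sum_sub_distrib]
    refine Finset.sum_congr rfl fun j _ => ?_
    simp only [φ]
    ring
  simp only [hφb] at hk
  have hΓmono : Monotone (partialSum (reorder σ γ)) := monotone_partialSum fun i => (hγ _).le
  have hΓ0 : 0 < partialSum (reorder σ γ) k := by
    have h1 : 0 < γ (σ⁻¹ ⟨0, by omega⟩) := hγ _
    have h2 := partialSum_succ (reorder σ γ) ⟨0, by omega⟩
    have h3 := hΓmono (show 0 + 1 ≤ k from hk0)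
    simp only [partialSum_zero, reorder] at h2 h3 ⊢
    linarith
  have hΓ1 : partialSum (reorder σ γ) k < 1 := by
    have h1 : 0 < reorder σ γ ⟨k, hkd⟩ := hγ _
    have h2 := partialSum_succ (reorder σ γ) ⟨k, hkd⟩
    have h3 := partialSum_le_sum (v := reorder σ γ) (fun i => (hγ _).le) (k + 1)
    rw [sum_reorder, hγ1] at h3
    simp only [] at h2
    linarith
  -- If `p` is strictly above the diagonal at the elbow, pulling back the indicator of its first `k`
  -- levels along `Λ` gives a weight whose pairing with `q` equals that partial sum of `p`, and the
  -- push raises it. Otherwise it suffices that `q` is strictly above the diagonal there.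
  rcases lt_or_ge (partialSum (reorder σ γ) k) (partialSum (reorder σ p) k) with hlt | hge
  · obtain ⟨-, Λ, hΛ, hΛq⟩ := hq
    obtain ⟨hΛ0, hΛ1, hΛγ⟩ := mem_gibbsPreserving.1 hΛ
    let S : Finset (Fin d) := Finset.univ.filter fun i => i.val < k
    have hswap : ∀ v : Fin d → ℝ, ∑ j, (∑ i ∈ S, Λ (σ⁻¹ i) j) * v j =
        partialSum (reorder σ (Λ *ᵥ v)) k := fun v => by
      simp only [Finset.sum_mul]
      rw [Finset.sum_comm]
      rfl
    have hγeq : Λ *ᵥ γ = γ := hΛ.2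
    have h := hk (fun j => ∑ i ∈ S, Λ (σ⁻¹ i) j) (fun j => Finset.sum_nonneg fun i _ => hΛ0 _ _)
      (fun j => by
        rw [← hΛ1 j, ← Equiv.sum_comp σ⁻¹ fun i => Λ i j]
        exact Finset.sum_le_sum_of_subset_of_nonneg (Finset.subset_univ _) fun i _ _ => hΛ0 _ _)
      (by rw [hswap, hγeq])
    rw [hswap, hswap, hγeq, hΛq] at h
    nlinarith
  · obtain ⟨b, hb0, hb1, hbγ, hbq⟩ := exists_weight_gt hγ hγ1 hq1 hqγ hΓ0 hΓ1
    have h := hk b hb0 hb1 hbγ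
    rw [hbγ] at h
    nlinarith

end Region

section Gibbs

variable {d : ℕ} (β : ℝ) (E : Fin d → ℝ)

lemma sum_exp_pos (i : Fin d) : 0 < ∑ j, Real.exp (-β * E j) :=
  Finset.sum_pos (fun _ _ => Real.exp_pos _) ⟨i, Finset.mem_univ i⟩

lemma gibbsState_pos (i : Fin d) : 0 < gibbsState β E i :=
  div_pos (Real.exp_pos _) (sum_exp_pos β E i)

lemma sum_gibbsState [NeZero d] : ∑ i, gibbsState β E i = 1 := by
  simp only [gibbsState]
  rw [← Finset.sum_div, div_self (sum_exp_pos β E 0).ne']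

end Gibbs

theorem mainTheorem4 {d : ℕ} (β : ℝ) (E : Fin d → ℝ) (p : Fin d → ℝ)
    (hp : p ∈ stdSimplex ℝ (Fin d)) (σ : Equiv.Perm (Fin d))
    (hσ : IsBetaOrdering (gibbsState β E) p σ) :
    incomparableRegion (gibbsState β E) p =
      (quasiInterior (tangentRegion (gibbsState β E) p σ) \ futureCone (gibbsState β E) p) ∩
        stdSimplex ℝ (Fin d) := by
  have hd : NeZero d := ⟨by
    rintro rfl
    simpa using hp.2⟩
  have hγ := gibbsState_pos β E
  have hγ1 := sum_gibbsState β E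
  ext q
  constructor
  · rintro ⟨hq, hfut, hpast⟩
    refine ⟨⟨?_, hfut⟩, hq⟩
    obtain ⟨m, hm⟩ : ∃ m, excess (gibbsState β E) q m < excess (gibbsState β E) p m := by
      by_contra! hle
      exact hpast ⟨hq, mem_futureCone_of_excess_le hγ (hp.2.trans hq.2.symm) hle⟩
    exact mem_quasiInterior_of_excess_lt hγ hγ1 hp.2 hσ hq.2 hm
  · rintro ⟨⟨hint, hfut⟩, hq⟩
    exact ⟨hq, hfut, fun hpast =>
      notMem_quasiInterior_of_mem_pastCone hγ hγ1 hp.2 hσ hpast hfut hint⟩
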